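/- Let $I=[0,1]$ and let $PL_o(I)$ be the group, under composition, of orientation-preserving piecewise-linear homeomorphisms of $I$ with finitely many breaks in slope. For $H\le PL_o(I)$, an orbital of $H$ is the convex hull of the $H$-orbit of a point of $I$, provided that it has more than one element; an orbital of an element $g$ is an orbital of $\langle g\rangle$. Given distinct $f,g\in PL_o(I)$ there is a maximal $x\in[0,1)$ such that $f$ and $g$ agree on $[0,x]$; in the left total order of $PL_o(I)$, the larger of the two is the one with the larger right-hand derivative at $x$. A signed orbital of $G\le PL_o(I)$ is a pair $(A,g)$ with $g\in G$ and $A$ an orbital of $g$. Signed orbitals are partially ordered lexicographically, by inclusion in the first coordinate and by the left total order in the second. A tower of $G$ is a set $T$ of signed orbitals of $G$ that is a chain in this partial order and such that for each $A$ occurring as a first coordinate in $T$ there is exactly one element of $T$ of the form $(A,g)$. The depth of $G$ is the supremum of the cardinalities of the towers of $G$. Theorem. Let $G$ be a subgroup of $PL_o(I)$ and let $n\ge 0$ be an integer. Then $G$ is solvable of derived length $n$ (that is, $n$ is the least $k\ge 0$ for which the $k$-th term $G^{(k)}$ of the derived series of $G$, with $G^{(0)}=G$, is trivial) if and only if the depth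 of $G$ is $n$. -/

import Mathlib

open scoped unitInterval

/-- A self-map of the unit interval is piecewise linear (with finitely many breaks in slope) if
there is a finite set of points such that the map is affine on every closed subinterval
whose interior contains none of these points. -/
def IsPiecewiseLinear (f : I → I) : Prop :=
  ∃ B : Finset I, ∀ a b : I, (∀ t ∈ B, t ∉ Set.Ioo a b) →
    ∃ m c : ℝ, ∀ x ∈ Set.Icc a b, (f x : ℝ) = m * (x : ℝ) + c

theorem IsPiecewiseLinear.id : IsPiecewiseLinear (fun x => x) :=
  ⟨∅, fun _ _ _ => ⟨1, 0, fun x _ => by ring⟩⟩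

theorem IsPiecewiseLinear.comp {f g : I ≃ₜ I} (hg' : StrictMono g)
    (hf : IsPiecewiseLinear f) (hg : IsPiecewiseLinear g) :
    IsPiecewiseLinear (fun x => f (g x)) := by
  classical
  obtain ⟨B, hB⟩ := hf
  obtain ⟨C, hC⟩ := hg
  refine ⟨C ∪ B.image g.symm, fun a b hab => ?_⟩
  obtain ⟨m, c, h1⟩ := hC a b (fun t ht => hab t (Finset.mem_union_left _ ht))
  obtain ⟨k, d, h2⟩ := hB (g a) (g b) (fun t ht h => by
    refine hab (g.symm t)
      (Finset.mem_union_right _ (Finset.mem_image_of_mem _ ht)) ⟨?_, ?_⟩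
    · apply hg'.lt_iff_lt.1; simpa using h.1
    · apply hg'.lt_iff_lt.1; simpa using h.2)
  refine ⟨k * m, k * c + d, fun x hx => ?_⟩
  rw [h2 (g x) ⟨hg'.monotone hx.1, hg'.monotone hx.2⟩, h1 x hx]
  ring

theorem Homeomorph.strictMono_symm_of_strictMono {f : I ≃ₜ I} (hf : StrictMono f) :
    StrictMono f.symm := fun a b h => by
  apply hf.lt_iff_lt.1
  simpa using h

theorem IsPiecewiseLinear.symm {f : I ≃ₜ I} (hf' : StrictMono f)
    (hf : IsPiecewiseLinear f) : IsPiecewiseLinear f.symm := by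
  classical
  obtain ⟨B, hB⟩ := hf
  refine ⟨B.image f, fun a b hab => ?_⟩
  have hs := Homeomorph.strictMono_symm_of_strictMono hf'
  rcases lt_or_ge a b with h | h
  · obtain ⟨m, c, h1⟩ := hB (f.symm a) (f.symm b) (fun t ht h => by
      refine hab (f t) (Finset.mem_image_of_mem _ ht) ⟨?_, ?_⟩
      · simpa using hf' h.1
      · simpa using hf' h.2)
    have key : ∀ x ∈ Set.Icc a b, (x : ℝ) = m * (f.symm x : ℝ) + c := fun x hx => by
      simpa using h1 (f.symm x) ⟨hs.monotone hx.1, hs.monotone hx.2⟩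
    have hm : m ≠ 0 := by
      rintro rfl
      have ha := key a ⟨le_rfl, h.le⟩
      have hb := key b ⟨h.le, le_rfl⟩
      have : (a : ℝ) < b := h
      linarith
    refine ⟨m⁻¹, -(m⁻¹ * c), fun x hx => ?_⟩
    rw [key x hx]
    field_simp
    ring
  · refine ⟨0, (f.symm a : ℝ), fun x hx => ?_⟩
    have : x = a := le_antisymm (hx.2.trans h) hx.1
    subst this
    ring

/-- The group `PL_o(I)` of orientation-preserving piecewise-linear homeomorphisms of the unit
interval with finitely many breaks in slope, under composition. -/
def PLo : Subgroup (I ≃ₜ I) where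
  carrier := {f | StrictMono f ∧ IsPiecewiseLinear f}
  mul_mem' := fun {_ _} hf hg => ⟨hf.1.comp hg.1, hf.2.comp hg.1 hg.2⟩
  one_mem' := ⟨strictMono_id, IsPiecewiseLinear.id⟩
  inv_mem' := fun {_} hf =>
    ⟨Homeomorph.strictMono_symm_of_strictMono hf.1, hf.2.symm hf.1⟩

namespace PLo

/-- The action of an element of `PL_o(I)` on the unit interval, with values read in `ℝ`. -/
def act (g : PLo) (x : I) : ℝ := ((g : I ≃ₜ I) x : ℝ)

/-- `A` is an orbital of the group `H`: the convex hull of the `H`-orbit of some point,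
having more than one element. -/
def IsOrbital (H : Subgroup PLo) (A : Set ℝ) : Prop :=
  ∃ x : I, A = convexHull ℝ {y : ℝ | ∃ h ∈ H, y = act h x} ∧ A.Nontrivial

/-- An orbital of an element `g` is an orbital of the cyclic group generated by `g`. -/
def IsElementOrbital (g : PLo) (A : Set ℝ) : Prop :=
  IsOrbital (Subgroup.zpowers g) A

/-- A signed orbital of `G`: a pair `(A, g)` with `g ∈ G` (the signature) and `A` an orbital
of `g`. -/
def IsSignedOrbital (G : Subgroup PLo) (p : Set ℝ × PLo) : Prop :=
  p.2 ∈ G ∧ IsElementOrbital p.2 p.1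

/-- The right-hand derivative of `g` at a point `x` of `[0, 1)`. The map is extended to `ℝ` by
constants, which does not affect right-hand derivatives at points of `[0, 1)`. -/
noncomputable def rightDeriv (g : PLo) (x : I) : ℝ :=
  derivWithin (Set.IccExtend zero_le_one (act g)) (Set.Ioi (x : ℝ)) (x : ℝ)

/-- The strict left order: `f` and `g` agree on `[0, x]` for some `x ∈ [0, 1)`, and `g` has the
larger right-hand derivative at `x` (so `x` is the largest point with this agreement). -/
def LeftLT (f g : PLo) : Prop :=
  ∃ x : I, x < 1 ∧ (∀ y ≤ x, act f y = act g y) ∧ rightDeriv f x < rightDeriv g x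

/-- The left total order of `PL_o(I)`. -/
def LeftLE (f g : PLo) : Prop := f = g ∨ LeftLT f g

/-- The lexicographic order on signed orbitals: inclusion of orbitals first, the left total
order of signatures second. -/
def SignedLE : Set ℝ × PLo → Set ℝ × PLo → Prop := Prod.Lex (· ⊂ ·) LeftLE

/-- A tower of `G`: a chain of signed orbitals of `G` in which each occurring orbital carries
exactly one signature. -/
structure IsTower (G : Subgroup PLo) (T : Set (Set ℝ × PLo)) : Prop where
  signedOrbital : ∀ p ∈ T, IsSignedOrbital G p
  chain : IsChain SignedLE T
  unique : ∀ A ∈ Prod.fst '' T, ∃! g : PLo, (A, g) ∈ T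

/-- The depth of `G`: the supremum of the cardinalities (heights) of its towers, where all
infinite cardinalities are read as `⊤`. -/
noncomputable def depth (G : Subgroup PLo) : ℕ∞ :=
  ⨆ T : {T : Set (Set ℝ × PLo) // IsTower G T}, (T : Set (Set ℝ × PLo)).encard

end PLo

/-- The group `G` is solvable of derived length `n`: `n` is the least index at which the derived
series of `G` (starting with `G` itself at index `0`) is trivial. -/
def HasDerivedLength (G : Type*) [Group G] (n : ℕ) : Prop :=
  IsLeast {k : ℕ | derivedSeries G k = ⊥} n

/-!
The signatures in a tower play no role beyond their existence, so the depth of `G` is the supremum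
of the lengths of chains, under inclusion, of orbitals of elements of `G`
(`PLo.natCast_le_depth_iff`). An orbital of an element `g` is a component `(a, b)` of its support,
called a bump of `g` (`PLo.isElementOrbital_iff`). By induction on `n`, it suffices to compare
chains for `G` with chains for its derived subgroup.

* A chain for the derived subgroup extends by one step in `G`. One-sided germs of elements of `G`
  at a global fixed point of `G` are linear, hence commute, so elements of the derived subgroup are
  trivial there. Thus no end of the largest orbital of the chain is a global fixed point, some
  element of `G` moves this orbital off itself, and the bump of that element that contains it is
  strictly larger (`PLo.exists_isBump_of_commutator`).

* If `G` is solvable, then a chain for `G`, with its largest member removed, is a chain for the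
  derived subgroup. First, bumps of elements of `G` cannot overlap properly. Otherwise two such
  elements generate a subgroup `H` whose derived subgroup `K` has trivial germs on the right of some
  point `u` that it fixes, but has no other fixed points near `u` (`PLo.exists_hasFreeGermAt`). This
  passes to the next derived subgroup (`PLo.HasFreeGermAt.commutator`): `K` acts on the fixed points
  of `⁅K, K⁆` through an abelian group, and any such point near `u` has translates under `K`
  arbitrarily close to `u`, where a given element of `K` is trivial, so that element would fix the
  point itself, and `K` would have a fixed point near `u`. So the derived series never reaches the
  trivial group. Secondly, in the absence of overlaps, nested bumps share no ends, and if a bump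
  `(a, b)` of `g` is properly inside a bump of `h`, then the commutator of `g` with a suitable power
  of `h` agrees with `g` on `[a, b]`
  (`PLo.IsLaminar.exists_isBump_commutator`).
-/

open Set Filter Topology
open scoped commutatorElement

namespace PLo

/-! ### The action on the interval -/

instance : MulAction PLo I where
  smul g x := (g : I ≃ₜ I) x
  one_smul _ := rfl
  mul_smul _ _ _ := rfl

theorem act_eq_coe_smul (g : PLo) (x : I) : act g x = ((g • x : I) : ℝ) := rfl

theorem smul_strictMono (g : PLo) : StrictMono (fun x : I => g • x) := g.2.1

theorem continuous_smul (g : PLo) : Continuous (fun x : I => g • x) :=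
  (g : I ≃ₜ I).continuous

@[simp]
theorem smul_lt_smul (g : PLo) {x y : I} : g • x < g • y ↔ x < y :=
  (smul_strictMono g).lt_iff_lt

@[simp]
theorem smul_le_smul (g : PLo) {x y : I} : g • x ≤ g • y ↔ x ≤ y :=
  (smul_strictMono g).le_iff_le

theorem ext_smul {g h : PLo} (H : ∀ x : I, g • x = h • x) : g = h :=
  Subtype.ext (Homeomorph.ext H)

/-- An element of `PL_o(I)` as an order isomorphism of the complete linear order `I`. -/
def toOrderIso (g : PLo) : I ≃o I where
  toEquiv := MulAction.toPerm g
  map_rel_iff' := smul_le_smul g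

theorem smul_sSup (g : PLo) (S : Set I) : g • sSup S = sSup ((fun x => g • x) '' S) := by
  have h := (toOrderIso g).map_sSup S
  rw [sSup_image]
  exact h

theorem smul_sInf (g : PLo) (S : Set I) : g • sInf S = sInf ((fun x => g • x) '' S) := by
  have h := (toOrderIso g).map_sInf S
  rw [sInf_image]
  exact h

/-- The set of common fixed points of the elements of `H` in `I`. -/
def fixedSet (H : Subgroup PLo) : Set I := {x | ∀ h ∈ H, h • x = x}

theorem sSup_mem_fixedSet {H : Subgroup PLo} {S : Set I} (hS : S ⊆ fixedSet H) :
    sSup S ∈ fixedSet H := by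
  intro h hh
  rw [smul_sSup]
  congr 1
  have : EqOn (fun x => h • x) id S := fun x hx => hS hx h hh
  rw [this.image_eq, image_id]

theorem sInf_mem_fixedSet {H : Subgroup PLo} {S : Set I} (hS : S ⊆ fixedSet H) :
    sInf S ∈ fixedSet H := by
  intro h hh
  rw [smul_sInf]
  congr 1
  have : EqOn (fun x => h • x) id S := fun x hx => hS hx h hh
  rw [this.image_eq, image_id]

theorem mem_fixedSet_zpowers {g : PLo} {x : I} :
    x ∈ fixedSet (Subgroup.zpowers g) ↔ g • x = x := by
  constructor
  · exact fun h => h g (Subgroup.mem_zpowers g)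
  · intro h k hk
    have : Subgroup.zpowers g ≤ MulAction.stabilizer PLo x := by
      rw [Subgroup.zpowers_le]; exact h
    exact this hk

theorem image_smul_orbit {H : Subgroup PLo} {g : PLo} (hg : g ∈ H) (p : I) :
    (fun x => g • x) '' {x : I | ∃ h ∈ H, x = h • p} = {x : I | ∃ h ∈ H, x = h • p} := by
  ext x
  constructor
  · rintro ⟨_, ⟨h, hh, rfl⟩, rfl⟩
    exact ⟨g * h, H.mul_mem hg hh, (mul_smul g h p).symm⟩
  · rintro ⟨h, hh, rfl⟩
    exact ⟨(g⁻¹ * h) • p, ⟨g⁻¹ * h, H.mul_mem (H.inv_mem hg) hh, rfl⟩, by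
      simp [mul_smul]⟩

/-- An orbit of `H` can only be blocked by fixed points of `H`: its infimum is fixed, so the orbit
of `p` goes below `y` unless `H` has a fixed point between `y` and `p`. -/
theorem exists_smul_lt {H : Subgroup PLo} {p y : I}
    (hfix : ∀ x, y ≤ x → x ≤ p → x ∉ fixedSet H) : ∃ h ∈ H, h • p < y := by
  by_contra! hcon
  refine hfix (sInf {x : I | ∃ h ∈ H, x = h • p}) ?_ ?_ ?_
  · refine le_sInf ?_
    rintro _ ⟨h, hh, rfl⟩
    exact hcon h hh
  · exact sInf_le ⟨1, H.one_mem, (one_smul _ _).symm⟩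
  · intro g hg
    rw [smul_sInf, image_smul_orbit hg]

/-- The mirror image of `exists_smul_lt`. -/
theorem exists_lt_smul {H : Subgroup PLo} {p y : I}
    (hfix : ∀ x, p ≤ x → x ≤ y → x ∉ fixedSet H) : ∃ h ∈ H, y < h • p := by
  by_contra! hcon
  refine hfix (sSup {x : I | ∃ h ∈ H, x = h • p}) ?_ ?_ ?_
  · exact le_sSup ⟨1, H.one_mem, (one_smul _ _).symm⟩
  · refine sSup_le ?_
    rintro _ ⟨h, hh, rfl⟩
    exact hcon h hh
  · intro g hg
    rw [smul_sSup, image_smul_orbit hg]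

/-! ### Bumps and element orbitals -/

/-- `(a, b)` is a connected component of the support of `g`. -/
structure IsBump (g : PLo) (a b : I) : Prop where
  lt : a < b
  left : g • a = a
  right : g • b = b
  moved : ∀ x, a < x → x < b → g • x ≠ x

theorem IsBump.inv {g : PLo} {a b : I} (h : IsBump g a b) : IsBump g⁻¹ a b where
  lt := h.lt
  left := by rw [inv_smul_eq_iff, h.left]
  right := by rw [inv_smul_eq_iff, h.right]
  moved x hx hx' e := h.moved x hx hx' (by rw [inv_smul_eq_iff] at e; exact e.symm)

theorem exists_isBump {g : PLo} {x : I} (hx : g • x ≠ x) :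
    ∃ a b, IsBump g a b ∧ a < x ∧ x < b := by
  have ha := sSup_mem_fixedSet (H := Subgroup.zpowers g)
    (S := {y | y ∈ fixedSet (Subgroup.zpowers g) ∧ y ≤ x}) fun y hy => hy.1
  have hb := sInf_mem_fixedSet (H := Subgroup.zpowers g)
    (S := {y | y ∈ fixedSet (Subgroup.zpowers g) ∧ x ≤ y}) fun y hy => hy.1
  set a := sSup {y | y ∈ fixedSet (Subgroup.zpowers g) ∧ y ≤ x} with ha'
  set b := sInf {y | y ∈ fixedSet (Subgroup.zpowers g) ∧ x ≤ y} with hb'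
  rw [mem_fixedSet_zpowers] at ha hb
  have hax : a < x := lt_of_le_of_ne (sSup_le fun y hy => hy.2) (by
    intro e; rw [e] at ha; exact hx ha)
  have hxb : x < b := lt_of_le_of_ne (le_sInf fun y hy => hy.2) (by
    intro e; rw [← e] at hb; exact hx hb)
  refine ⟨a, b, ⟨hax.trans hxb, ha, hb, fun y hay hyb e => ?_⟩, hax, hxb⟩
  rcases le_total y x with h | h
  · exact not_le_of_gt hay (le_sSup ⟨mem_fixedSet_zpowers.2 e, h⟩)
  · exact not_le_of_gt hyb (sInf_le ⟨mem_fixedSet_zpowers.2 e, h⟩)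

theorem IsBump.exists_zpow_lt {g : PLo} {a b p y : I} (h : IsBump g a b) (hp : p < b)
    (hy : a < y) : ∃ k ∈ Subgroup.zpowers g, k • p < y :=
  exists_smul_lt fun x hx hx' hf =>
    h.moved x (hy.trans_le hx) (hx'.trans_lt hp) (mem_fixedSet_zpowers.1 hf)

theorem IsBump.exists_lt_zpow {g : PLo} {a b p y : I} (h : IsBump g a b) (hp : a < p)
    (hy : y < b) : ∃ k ∈ Subgroup.zpowers g, y < k • p :=
  exists_lt_smul fun x hx hx' hf =>
    h.moved x (hp.trans_le hx) (hx'.trans_lt hy) (mem_fixedSet_zpowers.1 hf)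

theorem IsBump.zpow_left {g k : PLo} {a b : I} (h : IsBump g a b)
    (hk : k ∈ Subgroup.zpowers g) : k • a = a := mem_fixedSet_zpowers.2 h.left k hk

theorem IsBump.zpow_right {g k : PLo} {a b : I} (h : IsBump g a b)
    (hk : k ∈ Subgroup.zpowers g) : k • b = b := mem_fixedSet_zpowers.2 h.right k hk

theorem IsBump.convexHull_orbit {g : PLo} {a b x : I} (h : IsBump g a b) (hax : a < x)
    (hxb : x < b) :
    convexHull ℝ {y : ℝ | ∃ k ∈ Subgroup.zpowers g, y = act k x} = Ioo (a : ℝ) b := by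
  apply Subset.antisymm
  · refine convexHull_min ?_ (convex_Ioo _ _)
    rintro _ ⟨k, hk, rfl⟩
    rw [act_eq_coe_smul]
    have h1 : k • a < k • x := (smul_lt_smul k).2 hax
    have h2 : k • x < k • b := (smul_lt_smul k).2 hxb
    rw [h.zpow_left hk] at h1
    rw [h.zpow_right hk] at h2
    exact ⟨h1, h2⟩
  · intro y hy
    obtain ⟨z, rfl⟩ : ∃ z : I, (z : ℝ) = y :=
      ⟨⟨y, a.2.1.trans hy.1.le, hy.2.le.trans b.2.2⟩, rfl⟩
    obtain ⟨k, hk, hkz⟩ := h.exists_zpow_lt hxb (show a < z from hy.1)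
    obtain ⟨l, hl, hlz⟩ := h.exists_lt_zpow hax (show z < b from hy.2)
    have h1 : act k x ∈ {y : ℝ | ∃ k ∈ Subgroup.zpowers g, y = act k x} := ⟨k, hk, rfl⟩
    have h2 : act l x ∈ {y : ℝ | ∃ k ∈ Subgroup.zpowers g, y = act k x} := ⟨l, hl, rfl⟩
    exact (convex_convexHull ℝ _).ordConnected.out (subset_convexHull ℝ _ h1)
      (subset_convexHull ℝ _ h2) ⟨le_of_lt hkz, le_of_lt hlz⟩

theorem isElementOrbital_iff {g : PLo} {A : Set ℝ} :
    IsElementOrbital g A ↔ ∃ a b : I, IsBump g a b ∧ A = Ioo (a : ℝ) b := by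
  constructor
  · rintro ⟨x, hA, hnt⟩
    have hx : g • x ≠ x := by
      intro hx
      have : {y : ℝ | ∃ k ∈ Subgroup.zpowers g, y = act k x} ⊆ {(x : ℝ)} := by
        rintro _ ⟨k, hk, rfl⟩
        rw [act_eq_coe_smul, mem_fixedSet_zpowers.2 hx k hk]
        rfl
      have hsub : A ⊆ {(x : ℝ)} := by
        rw [hA]
        exact convexHull_min this (convex_singleton _)
      exact (not_nontrivial_singleton (hnt.mono hsub)).elim
    obtain ⟨a, b, hab, hax, hxb⟩ := exists_isBump hx
    exact ⟨a, b, hab, hA.trans (hab.convexHull_orbit hax hxb)⟩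
  · rintro ⟨a, b, hab, rfl⟩
    obtain ⟨x, hax, hxb⟩ := exists_between hab.lt
    refine ⟨x, (hab.convexHull_orbit hax hxb).symm, ?_⟩
    obtain ⟨z, haz, hzx⟩ := exists_between hax
    exact ⟨z, ⟨haz, hzx.trans hxb⟩, x, ⟨hax, hxb⟩, fun e => hzx.ne (Subtype.ext e)⟩

/-! ### Germs at fixed points -/

/-- The subgroup of elements that fix every point near the limit described by the filter `l`. -/
def germKernel (l : Filter I) : Subgroup PLo where
  carrier := {g | ∀ᶠ x in l, g • x = x}
  one_mem' := .of_forall fun x => one_smul _ x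
  mul_mem' := by
    intro g h hg hh
    filter_upwards [hg, hh] with x h1 h2
    rw [mul_smul, h2, h1]
  inv_mem' := by
    intro g hg
    filter_upwards [hg] with x hx
    rw [inv_smul_eq_iff, hx]

theorem mem_germKernel {l : Filter I} {g : PLo} :
    g ∈ germKernel l ↔ ∀ᶠ x in l, g • x = x := Iff.rfl

theorem eventually_affine_right (g : PLo) (u : I) :
    ∃ m c : ℝ, ∀ᶠ x in 𝓝[≥] u, ((g • x : I) : ℝ) = m * (x : ℝ) + c := by
  obtain ⟨B, hB⟩ := g.2.2
  suffices ∃ b : I, (∀ t ∈ B, t ∉ Ioo u b) ∧ Icc u b ∈ 𝓝[≥] u by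
    obtain ⟨b, hb, hmem⟩ := this
    obtain ⟨m, c, hmc⟩ := hB u b hb
    exact ⟨m, c, by filter_upwards [hmem] with x hx using hmc x hx⟩
  rcases (le_top : u ≤ ⊤).eq_or_lt with rfl | hu
  · exact ⟨⊤, fun t _ ht => not_lt_of_ge le_top ht.1, by
      rw [Icc_self, ← Ici_top]; exact self_mem_nhdsWithin⟩
  · have hfin : ((B : Set I) \ {u})ᶜ ∈ 𝓝[≥] u :=
      mem_nhdsWithin_of_mem_nhds
        ((B.finite_toSet.subset sdiff_subset).isClosed.isOpen_compl.mem_nhds (by simp))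
    obtain ⟨b, hb, hsub⟩ := (mem_nhdsGE_iff_exists_Ico_subset' hu).1 hfin
    exact ⟨b, fun t htB ht => hsub ⟨ht.1.le, ht.2⟩ ⟨htB, ht.1.ne'⟩, Icc_mem_nhdsGE hb⟩

theorem eventually_affine_left (g : PLo) (u : I) :
    ∃ m c : ℝ, ∀ᶠ x in 𝓝[≤] u, ((g • x : I) : ℝ) = m * (x : ℝ) + c := by
  obtain ⟨B, hB⟩ := g.2.2
  suffices ∃ b : I, (∀ t ∈ B, t ∉ Ioo b u) ∧ Icc b u ∈ 𝓝[≤] u by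
    obtain ⟨b, hb, hmem⟩ := this
    obtain ⟨m, c, hmc⟩ := hB b u hb
    exact ⟨m, c, by filter_upwards [hmem] with x hx using hmc x hx⟩
  rcases (bot_le : ⊥ ≤ u).eq_or_lt with rfl | hu
  · exact ⟨⊥, fun t _ ht => not_lt_of_ge bot_le ht.2, by
      rw [Icc_self, ← Iic_bot]; exact self_mem_nhdsWithin⟩
  · have hfin : ((B : Set I) \ {u})ᶜ ∈ 𝓝[≤] u :=
      mem_nhdsWithin_of_mem_nhds
        ((B.finite_toSet.subset sdiff_subset).isClosed.isOpen_compl.mem_nhds (by simp))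
    obtain ⟨b, hb, hsub⟩ := (mem_nhdsLE_iff_exists_Ioc_subset' hu).1 hfin
    exact ⟨b, fun t htB ht => hsub ⟨ht.1, ht.2.le⟩ ⟨htB, ht.2.ne⟩, Icc_mem_nhdsLE hb⟩

theorem tendsto_smul_nhdsWithin {g : PLo} {u : I} {s : Set I} (hg : g • u = u)
    (hs : ∀ x ∈ s, g • x ∈ s) : Tendsto (fun x : I => g • x) (𝓝[s] u) (𝓝[s] u) := by
  have h := (continuous_smul g).continuousWithinAt (s := s) (x := u)
  have h' := h.tendsto_nhdsWithin (t := s) hs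
  rwa [hg] at h'

/-- One-sided germs of piecewise linear maps at a common fixed point are linear, hence commute, so
a commutator of two such maps is the identity near the fixed point. The set `s` is the side. -/
theorem commutator_mem_germKernel {g h : PLo} {u : I} {s : Set I} (hu : u ∈ s)
    (hg : g • u = u) (hh : h • u = u)
    (hgs : ∀ x ∈ s, g • x ∈ s) (hhs : ∀ x ∈ s, h • x ∈ s)
    (hgs' : ∀ x ∈ s, g⁻¹ • x ∈ s) (hhs' : ∀ x ∈ s, h⁻¹ • x ∈ s)
    (hga : ∃ m c : ℝ, ∀ᶠ x in 𝓝[s] u, ((g • x : I) : ℝ) = m * (x : ℝ) + c)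
    (hha : ∃ m c : ℝ, ∀ᶠ x in 𝓝[s] u, ((h • x : I) : ℝ) = m * (x : ℝ) + c) :
    ⁅g, h⁆ ∈ germKernel (𝓝[s] u) := by
  obtain ⟨m, c, hga⟩ := hga
  obtain ⟨k, d, hha⟩ := hha
  have hgu := hga.self_of_nhdsWithin hu
  have hhu := hha.self_of_nhdsWithin hu
  rw [hg] at hgu
  rw [hh] at hhu
  have hcomm : ∀ᶠ x in 𝓝[s] u, g • h • x = h • g • x := by
    filter_upwards [hga, hha, (tendsto_smul_nhdsWithin hg hgs).eventually hha,
      (tendsto_smul_nhdsWithin hh hhs).eventually hga] with x h1 h2 h3 h4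
    apply Subtype.ext
    rw [h3, h4, h1, h2]
    linear_combination (1 - m) * hhu - (1 - k) * hgu
  have hg' : g⁻¹ • u = u := by rw [inv_smul_eq_iff, hg]
  have hh' : h⁻¹ • u = u := by rw [inv_smul_eq_iff, hh]
  have ht := (tendsto_smul_nhdsWithin hg' hgs').comp (tendsto_smul_nhdsWithin hh' hhs')
  rw [mem_germKernel]
  filter_upwards [ht.eventually hcomm] with x hx
  simpa [commutatorElement_def, mul_smul] using hx

theorem commutator_mem_germKernel_right {g h : PLo} {u : I} (hg : g • u = u) (hh : h • u = u) :
    ⁅g, h⁆ ∈ germKernel (𝓝[≥] u) := by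
  have key : ∀ k : PLo, k • u = u → ∀ x ∈ Ici u, k • x ∈ Ici u := fun k hk x hx => by
    have := (smul_le_smul k).2 hx
    rwa [hk] at this
  exact commutator_mem_germKernel self_mem_Ici hg hh (key g hg) (key h hh)
    (key _ (by rw [inv_smul_eq_iff, hg])) (key _ (by rw [inv_smul_eq_iff, hh]))
    (eventually_affine_right g u) (eventually_affine_right h u)

theorem commutator_mem_germKernel_left {g h : PLo} {u : I} (hg : g • u = u) (hh : h • u = u) :
    ⁅g, h⁆ ∈ germKernel (𝓝[≤] u) := by
  have key : ∀ k : PLo, k • u = u → ∀ x ∈ Iic u, k • x ∈ Iic u := fun k hk x hx => by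
    have := (smul_le_smul k).2 hx
    rwa [hk] at this
  exact commutator_mem_germKernel self_mem_Iic hg hh (key g hg) (key h hh)
    (key _ (by rw [inv_smul_eq_iff, hg])) (key _ (by rw [inv_smul_eq_iff, hh]))
    (eventually_affine_left g u) (eventually_affine_left h u)

theorem commutator_le_germKernel_right {H : Subgroup PLo} {u : I} (hu : u ∈ fixedSet H) :
    ⁅H, H⁆ ≤ germKernel (𝓝[≥] u) :=
  Subgroup.commutator_le.2 fun g hg h hh => commutator_mem_germKernel_right (hu g hg) (hu h hh)

theorem commutator_le_germKernel_left {H : Subgroup PLo} {u : I} (hu : u ∈ fixedSet H) :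
    ⁅H, H⁆ ≤ germKernel (𝓝[≤] u) :=
  Subgroup.commutator_le.2 fun g hg h hh => commutator_mem_germKernel_left (hu g hg) (hu h hh)

theorem exists_fixed_Icc {g : PLo} {u w : I} (hg : g ∈ germKernel (𝓝[≥] u)) (huw : u < w) :
    ∃ y, u < y ∧ y < w ∧ ∀ x, u ≤ x → x ≤ y → g • x = x := by
  obtain ⟨b, hb, hsub⟩ := (mem_nhdsGE_iff_exists_Ico_subset' huw).1 (mem_germKernel.1 hg)
  obtain ⟨y, hy, hyb⟩ := exists_between (lt_min hb huw : u < min b w)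
  exact ⟨y, hy, hyb.trans_le (min_le_right _ _), fun x h1 h2 =>
    hsub ⟨h1, h2.trans_lt (hyb.trans_le (min_le_left _ _))⟩⟩

theorem IsBump.notMem_germKernel_right {g : PLo} {a b : I} (h : IsBump g a b) :
    g ∉ germKernel (𝓝[≥] a) := fun hg => by
  obtain ⟨y, hy, hyb, hfix⟩ := exists_fixed_Icc hg h.lt
  exact h.moved y hy hyb (hfix y hy.le le_rfl)

theorem IsBump.notMem_germKernel_left {g : PLo} {a b : I} (h : IsBump g a b) :
    g ∉ germKernel (𝓝[≤] b) := fun hg => by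
  obtain ⟨w, hw, hsub⟩ := (mem_nhdsLE_iff_exists_Ioc_subset' h.lt).1 (mem_germKernel.1 hg)
  obtain ⟨y, hy, hyb⟩ := exists_between (max_lt hw h.lt : max w a < b)
  exact h.moved y ((le_max_right _ _).trans_lt hy) hyb
    (hsub ⟨(le_max_left _ _).trans_lt hy, hyb.le⟩)

/-- A linear germ on the right of a fixed point `u` is either trivial or without other fixed points
near `u`; in the second case `u` is the left end of a bump. -/
theorem mem_germKernel_or_exists_isBump {g : PLo} {u : I} (hu : u < 1) (hg : g • u = u) :
    g ∈ germKernel (𝓝[≥] u) ∨ ∃ t, IsBump g u t := by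
  obtain ⟨m, c, hmc⟩ := eventually_affine_right g u
  obtain ⟨w, hw, hsub⟩ := (mem_nhdsGE_iff_exists_Ico_subset' hu).1 hmc
  have hgu : (u : ℝ) = m * u + c := by simpa [hg] using hsub (left_mem_Ico.2 hw)
  by_cases hm : m = 1
  · left
    rw [mem_germKernel]
    filter_upwards [hmc] with x hx
    apply Subtype.ext
    rw [hx]
    subst hm
    linarith
  · right
    have hmove : ∀ x, u < x → x < w → g • x ≠ x := by
      intro x hux hxw e
      have hx : ((g • x : I) : ℝ) = m * x + c := hsub ⟨hux.le, hxw⟩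
      rw [e] at hx
      have hlt : (u : ℝ) < x := hux
      apply hm
      have : (m - 1) * ((x : ℝ) - u) = 0 := by linarith
      rcases mul_eq_zero.1 this with h | h <;> linarith
    obtain ⟨x, hux, hxw⟩ := exists_between (mem_Ioi.1 hw)
    obtain ⟨s, t, hst, hsx, hxt⟩ := exists_isBump (hmove x hux hxw)
    have hsu : s = u := by
      rcases lt_trichotomy s u with h | h | h
      · exact (hst.moved u h (hux.trans hxt) hg).elim
      · exact h
      · exact (hmove s h (hsx.trans hxw) hst.left).elim
    exact ⟨t, hsu ▸ hst⟩

/-! ### Overlapping bumps obstruct solvability -/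

/-- The derived series of `G`, as subgroups of `PL_o(I)`; `derivedSubgroup G (n + 1)` is by
definition `derivedSubgroup ⁅G, G⁆ n`. -/
def derivedSubgroup (G : Subgroup PLo) (n : ℕ) : Subgroup PLo := (fun H => ⁅H, H⁆)^[n] G

@[simp]
theorem derivedSubgroup_zero (G : Subgroup PLo) : derivedSubgroup G 0 = G := rfl

theorem derivedSubgroup_mono {G H : Subgroup PLo} (h : G ≤ H) (n : ℕ) :
    derivedSubgroup G n ≤ derivedSubgroup H n := by
  induction n generalizing G H with
  | zero => exact h
  | succ n ih => exact ih (Subgroup.commutator_mono h h)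

theorem map_derivedSeries (G : Subgroup PLo) (n : ℕ) :
    (derivedSeries G n).map G.subtype = derivedSubgroup G n := by
  induction n with
  | zero => rw [derivedSeries_zero, ← MonoidHom.range_eq_map, G.range_subtype]; rfl
  | succ n ih =>
    rw [derivedSeries_succ, Subgroup.map_commutator, ih]
    exact (Function.iterate_succ_apply' (fun H : Subgroup PLo => ⁅H, H⁆) n G).symm

theorem derivedSeries_eq_bot_iff (G : Subgroup PLo) (n : ℕ) :
    derivedSeries G n = ⊥ ↔ derivedSubgroup G n = ⊥ := by
  rw [← map_derivedSeries, Subgroup.map_eq_bot_iff_of_injective _ G.subtype_injective]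

theorem smul_mem_fixedSet_commutator {H : Subgroup PLo} {w : PLo} (hw : w ∈ H) {x : I}
    (hx : x ∈ fixedSet ⁅H, H⁆) : w • x ∈ fixedSet ⁅H, H⁆ := by
  intro k hk
  have hmem : ⁅w⁻¹, k⁆ * k ∈ ⁅H, H⁆ :=
    Subgroup.mul_mem _ (Subgroup.commutator_mem_commutator (H.inv_mem hw)
      (Subgroup.commutator_le_self H hk)) hk
  have h := hx _ hmem
  rw [show ⁅w⁻¹, k⁆ * k = w⁻¹ * k * w by rw [commutatorElement_def]; group] at h
  rwa [mul_smul, mul_smul, inv_smul_eq_iff] at h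

/-- `H` acts on the fixed points of its derived subgroup through an abelian quotient, so stabilizers
are constant along orbits there. -/
theorem smul_smul_of_mem_fixedSet_commutator {H : Subgroup PLo} {w v : PLo} (hw : w ∈ H)
    (hv : v ∈ H) {x : I} (hx : x ∈ fixedSet ⁅H, H⁆) (hwx : w • x = x) : w • v • x = v • x := by
  have h := hx _ (Subgroup.commutator_mem_commutator (H.inv_mem hv) hw)
  rw [commutatorElement_def, mul_smul, mul_smul, mul_smul, inv_inv, inv_smul_eq_iff,
    show w⁻¹ • x = x by rw [inv_smul_eq_iff, hwx]] at h
  exact h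

/-- `K` acts on the right of `u` by maps with trivial germ at `u`, and without common fixed point
near `u`. This obstruction to solvability passes to the derived subgroup. -/
def HasFreeGermAt (K : Subgroup PLo) (u : I) : Prop :=
  K ≤ germKernel (𝓝[≥] u) ∧ ∃ v, u < v ∧ ∀ x, u < x → x < v → x ∉ fixedSet K

theorem HasFreeGermAt.commutator {K : Subgroup PLo} {u : I} (h : HasFreeGermAt K u) :
    HasFreeGermAt ⁅K, K⁆ u := by
  obtain ⟨hgerm, v, huv, hfree⟩ := h
  have hu : u ∈ fixedSet K := fun k hk =>
    (mem_germKernel.1 (hgerm hk)).self_of_nhdsWithin self_mem_Ici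
  refine ⟨(Subgroup.commutator_le_self K).trans hgerm, v, huv, fun p hup hpv hp => ?_⟩
  refine hfree p hup hpv fun f hf => ?_
  -- The orbit of `p` accumulates at `u`, so it meets the region where `f` is the identity.
  obtain ⟨y, huy, -, hy⟩ := exists_fixed_Icc (hgerm hf) huv
  obtain ⟨w, hw, hwp⟩ := exists_smul_lt (H := K) (p := p) (y := y) fun x hx hx' =>
    hfree x (huy.trans_le hx) (hx'.trans_lt hpv)
  have huw : u < w • p := by
    have := (smul_lt_smul w).2 hup
    rwa [hu w hw] at this
  have := smul_smul_of_mem_fixedSet_commutator hf (K.inv_mem hw)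
    (smul_mem_fixedSet_commutator hw hp) (hy _ huw.le hwp.le)
  rwa [inv_smul_smul] at this

theorem HasFreeGermAt.ne_bot {K : Subgroup PLo} {u : I} (h : HasFreeGermAt K u) : K ≠ ⊥ := by
  rintro rfl
  obtain ⟨-, v, huv, hfree⟩ := h
  obtain ⟨x, hux, hxv⟩ := exists_between huv
  refine hfree x hux hxv fun k hk => ?_
  rw [Subgroup.mem_bot.1 hk, one_smul]

theorem HasFreeGermAt.derivedSubgroup_ne_bot {K : Subgroup PLo} {u : I}
    (h : HasFreeGermAt K u) (n : ℕ) : derivedSubgroup K n ≠ ⊥ := by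
  induction n generalizing K with
  | zero => exact h.ne_bot
  | succ n ih => exact ih h.commutator

theorem mem_fixedSet_closure_pair {g h : PLo} {x : I} :
    x ∈ fixedSet (Subgroup.closure {g, h}) ↔ g • x = x ∧ h • x = x := by
  constructor
  · exact fun H => ⟨H g (Subgroup.subset_closure (by simp)),
      H h (Subgroup.subset_closure (by simp))⟩
  · rintro ⟨hg, hh⟩ k hk
    have : Subgroup.closure {g, h} ≤ MulAction.stabilizer PLo x := by
      rw [Subgroup.closure_le]
      rintro k (rfl | rfl)
      exacts [hg, hh]
    exact this hk

theorem smul_eq_self_of_le {g : PLo} {q : I} (h : g • q ≤ q) (h' : g⁻¹ • q ≤ q) : g • q = q := by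
  refine le_antisymm h ?_
  have := (smul_le_smul g).2 h'
  rwa [smul_inv_smul] at this

/-- Two overlapping bumps generate a group whose derived subgroup has a free germ at the largest
common fixed point `u` to the left of both bumps. -/
theorem exists_hasFreeGermAt {g h : PLo} {a b c d : I} (hg : IsBump g a b) (hh : IsBump h c d)
    (hac : a < c) (hcb : c < b) (hbd : b < d) :
    ∃ u, HasFreeGermAt ⁅Subgroup.closure {g, h}, Subgroup.closure {g, h}⁆ u := by
  set H := Subgroup.closure {g, h} with hH
  have hgH : g ∈ H := Subgroup.subset_closure (by simp)
  have hhH : h ∈ H := Subgroup.subset_closure (by simp)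
  set u := sSup {x | x ∈ fixedSet H ∧ x ≤ a} with hu
  have huH : u ∈ fixedSet H := sSup_mem_fixedSet fun x hx => hx.1
  have hua : u ≤ a := sSup_le fun x hx => hx.2
  have hfree : ∀ x, u < x → x < b → x ∉ fixedSet H := by
    intro x hux hxb hx
    rcases le_or_gt x a with h1 | h1
    · exact not_le_of_gt hux (le_sSup ⟨hx, h1⟩)
    · exact hg.moved x h1 hxb (hx g hgH)
  refine ⟨u, commutator_le_germKernel_right huH, b, hua.trans_lt hg.lt, fun p hup hpb hp => ?_⟩
  -- The last fixed point `q` of the derived subgroup before `b` is fixed by `g`.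
  set q := sSup {x | x ∈ fixedSet ⁅H, H⁆ ∧ x ≤ b} with hq
  have hqF : q ∈ fixedSet ⁅H, H⁆ := sSup_mem_fixedSet fun x hx => hx.1
  have hqb : q ≤ b := sSup_le fun x hx => hx.2
  have hpq : p ≤ q := le_sSup ⟨hp, hpb.le⟩
  have hle : ∀ w ∈ H, w • q ≤ b → w • q ≤ q := fun w hw hwb =>
    le_sSup ⟨smul_mem_fixedSet_commutator hw hqF, hwb⟩
  have hgq : g • q = q := by
    refine smul_eq_self_of_le (hle g hgH ?_) (hle _ (H.inv_mem hgH) ?_)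
    · have := (smul_le_smul g).2 hqb
      rwa [hg.right] at this
    · have := (smul_le_smul g⁻¹).2 hqb
      rwa [hg.inv.right] at this
  rcases hqb.eq_or_lt with hqb' | hqb'
  · -- If `q = b`, then `g` fixes the translates of `b` under powers of `h`, but one of them lies
    -- in `(c, b)`.
    obtain ⟨y, hcy, hyb⟩ := exists_between hcb
    obtain ⟨k, hk, hkb⟩ := hh.exists_zpow_lt hbd hcy
    have hck : c < k • b := by
      have := (smul_lt_smul k).2 hcb
      rwa [hh.zpow_left hk] at this
    have hkH : k ∈ H := (Subgroup.zpowers_le.2 hhH) hk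
    refine hg.moved (k • b) (hac.trans hck) (hkb.trans hyb) ?_
    rw [← hqb']
    exact smul_smul_of_mem_fixedSet_commutator hgH hkH hqF hgq
  · rcases lt_or_ge a q with haq | hqa
    · exact hg.moved q haq hqb' hgq
    · -- If `q ≤ a`, then `q` is also the last such point before `c`, hence fixed by `h` too.
      have hqc : q ≤ c := hqa.trans hac.le
      have hhq : h • q = q := by
        refine smul_eq_self_of_le (hle h hhH ?_) (hle _ (H.inv_mem hhH) ?_)
        · have := (smul_le_smul h).2 hqc
          rw [hh.left] at this
          exact this.trans hcb.le
        · have := (smul_le_smul h⁻¹).2 hqc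
          rw [hh.inv.left] at this
          exact this.trans hcb.le
      exact hfree q (hup.trans_le hpq) hqb' (mem_fixedSet_closure_pair.2 ⟨hgq, hhq⟩)

/-- No two bumps of elements of `G` overlap properly: any two are nested or disjoint. -/
def IsLaminar (G : Subgroup PLo) : Prop :=
  ∀ g ∈ G, ∀ h ∈ G, ∀ a b c d, IsBump g a b → IsBump h c d → a < c → c < b → d ≤ b

theorem isLaminar_of_derivedSubgroup_eq_bot {G : Subgroup PLo} {n : ℕ}
    (hG : derivedSubgroup G n = ⊥) : IsLaminar G := by
  intro g hg h hh a b c d hgab hhcd hac hcb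
  by_contra! hbd
  obtain ⟨u, hu⟩ := exists_hasFreeGermAt hgab hhcd hac hcb hbd
  have hle : Subgroup.closure {g, h} ≤ G := by
    rw [Subgroup.closure_le]
    rintro k (rfl | rfl)
    exacts [hg, hh]
  have h1 := derivedSubgroup_mono
    ((Subgroup.commutator_le_self (Subgroup.closure {g, h})).trans hle) n
  rw [hG, le_bot_iff] at h1
  exact hu.derivedSubgroup_ne_bot n h1

/-! ### Nested bumps in laminar groups -/

theorem commutator_smul_ne {g h : PLo} {x : I} (hg : g • x = x)
    (hgh : g • h⁻¹ • x ≠ h⁻¹ • x) : ⁅g, h⁆ • x ≠ x := by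
  intro e
  apply hgh
  rw [commutatorElement_def, mul_smul, mul_smul, mul_smul, ← eq_inv_smul_iff, ← eq_inv_smul_iff,
    show g⁻¹ • x = x by rw [inv_smul_eq_iff, hg], inv_smul_eq_iff] at e
  exact e.symm

/-- In a laminar group, a bump is not properly contained in one with the same left end `a`: the
commutator of the two elements would be trivial near `a`, but would move the other end of the
smaller bump, and so would have a bump overlapping the smaller one. -/
theorem IsLaminar.le_of_left_eq {G : Subgroup PLo} (hG : IsLaminar G) {g h : PLo} (hg : g ∈ G)
    (hh : h ∈ G) {a b d : I} (hgab : IsBump g a b) (hhad : IsBump h a d) : d ≤ b := by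
  by_contra! hbd
  have key : ∀ h ∈ G, IsBump h a d → ¬ h⁻¹ • b < b := by
    intro h hh hhad hlt
    have hlo : a < h⁻¹ • b := by
      have := (smul_lt_smul h⁻¹).2 hgab.lt
      rwa [hhad.inv.left] at this
    obtain ⟨s, t, hst, hsb, hbt⟩ :=
      exists_isBump (commutator_smul_ne hgab.right (hgab.moved _ hlo hlt))
    have hker := commutator_mem_germKernel_right hgab.left hhad.left
    have has : a < s := by
      rcases lt_trichotomy a s with h1 | rfl | h1
      · exact h1
      · exact (hst.notMem_germKernel_right hker).elim
      · exact (hst.moved a h1 (hgab.lt.trans hbt)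
          ((mem_germKernel.1 hker).self_of_nhdsWithin self_mem_Ici)).elim
    have hcG : ⁅g, h⁆ ∈ G :=
      Subgroup.commutator_le_self G (Subgroup.commutator_mem_commutator hg hh)
    exact not_le_of_gt hbt (hG g hg _ hcG a b s t hgab hst has hsb)
  rcases lt_trichotomy (h⁻¹ • b) b with h1 | h1 | h1
  · exact key h hh hhad h1
  · exact hhad.inv.moved b hgab.lt hbd h1
  · refine key h⁻¹ (G.inv_mem hh) hhad.inv ?_
    have := (smul_lt_smul h).2 h1
    rwa [smul_inv_smul, ← inv_inv h] at this

/-- The mirror image of `IsLaminar.le_of_left_eq`. -/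
theorem IsLaminar.le_of_right_eq {G : Subgroup PLo} (hG : IsLaminar G) {g h : PLo} (hg : g ∈ G)
    (hh : h ∈ G) {a b c : I} (hgab : IsBump g a b) (hhcb : IsBump h c b) : a ≤ c := by
  by_contra! hca
  have key : ∀ h ∈ G, IsBump h c b → ¬ a < h⁻¹ • a := by
    intro h hh hhcb hlt
    have hlo : h⁻¹ • a < b := by
      have := (smul_lt_smul h⁻¹).2 hgab.lt
      rwa [hhcb.inv.right] at this
    obtain ⟨s, t, hst, hsa, hat⟩ :=
      exists_isBump (commutator_smul_ne hgab.left (hgab.moved _ hlt hlo))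
    have hker := commutator_mem_germKernel_left hgab.right hhcb.right
    have htb : t < b := by
      rcases lt_trichotomy t b with h1 | rfl | h1
      · exact h1
      · exact (hst.notMem_germKernel_left hker).elim
      · exact (hst.moved b (hsa.trans hgab.lt) h1
          ((mem_germKernel.1 hker).self_of_nhdsWithin self_mem_Iic)).elim
    have hcG : ⁅g, h⁆ ∈ G :=
      Subgroup.commutator_le_self G (Subgroup.commutator_mem_commutator hg hh)
    exact not_le_of_gt htb (hG _ hcG g hg s t a b hst hgab hsa hat)
  rcases lt_trichotomy (h⁻¹ • a) a with h1 | h1 | h1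
  · refine key h⁻¹ (G.inv_mem hh) hhcb.inv ?_
    have := (smul_lt_smul h).2 h1
    rwa [smul_inv_smul, ← inv_inv h] at this
  · exact hhcb.inv.moved a hca hgab.lt h1
  · exact key h hh hhcb h1

/-- In a laminar group, a bump of `g` properly inside a bump `(c, d)` of `h` is also a bump of the
commutator of `g` with a suitable power `k` of `h`: `g` is trivial near `c`, and if `k⁻¹` takes
`[a, b]` into the region near `c` where `g` is trivial, then `⁅g, k⁆` agrees with `g` on
`[a, b]`. -/
theorem IsLaminar.exists_isBump_commutator {G : Subgroup PLo} (hG : IsLaminar G) {g h : PLo}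
    (hg : g ∈ G) (hh : h ∈ G) {a b c d : I} (hgab : IsBump g a b) (hhcd : IsBump h c d)
    (hca : c ≤ a) (hbd : b ≤ d) (hne : a ≠ c ∨ b ≠ d) : ∃ f ∈ ⁅G, G⁆, IsBump f a b := by
  have hca' : c < a := by
    refine lt_of_le_of_ne hca ?_
    rintro rfl
    exact hne.elim (fun e => e rfl) fun e => e (le_antisymm hbd
      (hG.le_of_left_eq hg hh hgab hhcd))
  have hbd' : b < d := by
    refine lt_of_le_of_ne hbd ?_
    rintro rfl
    exact not_le_of_gt hca' (hG.le_of_right_eq hg hh hgab hhcd)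
  have hgc : g • c = c := by
    by_contra hgc
    -- Otherwise a bump of `g` around `c` would end before `a`, overlapping `(c, d)`.
    obtain ⟨s, t, hst, hsc, hct⟩ := exists_isBump hgc
    have hta : t ≤ a := by
      by_contra! h1
      exact hst.moved a (hsc.trans hca') h1 hgab.left
    exact not_le_of_gt (hta.trans_lt (hgab.lt.trans hbd'))
      (hG g hg h hh s t c d hst hhcd hsc hct)
  have hker : g ∈ germKernel (𝓝[≥] c) := by
    refine (mem_germKernel_or_exists_isBump (hhcd.lt.trans_le d.2.2) hgc).resolve_right ?_
    rintro ⟨t, ht⟩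
    have hta : t ≤ a := by
      by_contra! h1
      exact ht.moved a hca' h1 hgab.left
    exact not_le_of_gt (hta.trans_lt (hgab.lt.trans hbd')) (hG.le_of_left_eq hg hh ht hhcd)
  obtain ⟨x, hcx, -, hx⟩ := exists_fixed_Icc hker hca'
  obtain ⟨k, hk, hkx⟩ := hhcd.exists_lt_zpow hcx hbd'
  have hagree : ∀ z, a ≤ z → z ≤ b → ⁅g, k⁆ • z = g • z := by
    intro z haz hzb
    have h1 : k⁻¹ • z ≤ x := by
      rw [← smul_le_smul k, smul_inv_smul]
      exact hzb.trans hkx.le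
    have h2 : c ≤ k⁻¹ • z := by
      rw [← smul_le_smul k, smul_inv_smul, hhcd.zpow_left hk]
      exact hca.trans haz
    have h3 : g⁻¹ • k⁻¹ • z = k⁻¹ • z := by rw [inv_smul_eq_iff, hx _ h2 h1]
    rw [commutatorElement_def, mul_smul, mul_smul, mul_smul, h3, smul_inv_smul]
  refine ⟨⁅g, k⁆, Subgroup.commutator_mem_commutator hg ((Subgroup.zpowers_le.2 hh) hk),
    hgab.lt, ?_, ?_, fun z haz hzb => ?_⟩
  · rw [hagree a le_rfl hgab.lt.le, hgab.left]
  · rw [hagree b hgab.lt.le le_rfl, hgab.right]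
  · rw [hagree z haz.le hzb.le]
    exact hgab.moved z haz hzb

/-- An element of the derived subgroup has trivial germs at the global fixed points of `G`, so the
ends of its bumps are moved by `G`; an element of `G` moving such a bump off itself has a strictly
larger bump. -/
theorem exists_isBump_of_commutator {G : Subgroup PLo} {f : PLo} (hf : f ∈ ⁅G, G⁆) {s t : I}
    (h : IsBump f s t) : ∃ g ∈ G, ∃ a b, IsBump g a b ∧ a < s ∧ t < b := by
  obtain ⟨g, hg, hgs⟩ := exists_lt_smul (H := G) (p := s) (y := t) fun x hsx hxt hx => by
    rcases hsx.eq_or_lt with rfl | hsx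
    · exact h.notMem_germKernel_right (commutator_le_germKernel_right hx hf)
    rcases hxt.eq_or_lt with rfl | hxt
    · exact h.notMem_germKernel_left (commutator_le_germKernel_left hx hf)
    · exact h.moved x hsx hxt (hx f (Subgroup.commutator_le_self G hf))
  obtain ⟨a, b, hab, has, hsb⟩ := exists_isBump (h.lt.trans hgs).ne'
  refine ⟨g, hg, a, b, hab, has, hgs.trans ?_⟩
  have := (smul_lt_smul g).2 hsb
  rwa [hab.right] at this

/-! ### Chains of element orbitals and depth -/

/-- `G` has a chain of `n` nested orbitals of its elements. -/
def HasOrbitalChain (G : Subgroup PLo) (n : ℕ) : Prop :=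
  ∃ s : Finset (Set ℝ), s.card = n ∧ IsChain (· ⊆ ·) (s : Set (Set ℝ)) ∧
    ∀ A ∈ s, ∃ g ∈ G, IsElementOrbital g A

theorem natCast_le_depth_iff {G : Subgroup PLo} {n : ℕ} :
    (n : ℕ∞) ≤ depth G ↔ HasOrbitalChain G n := by
  classical
  constructor
  · intro hn
    cases n with
    | zero => exact ⟨∅, rfl, by simp, by simp⟩
    | succ n =>
      have hlt : (n : ℕ∞) < depth G := lt_of_lt_of_le (by exact_mod_cast n.lt_succ_self) hn
      obtain ⟨⟨T, hT⟩, hnT⟩ := lt_iSup_iff.1 hlt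
      obtain ⟨S, hST, hS⟩ := exists_subset_encard_eq (Order.add_one_le_of_lt hnT)
      have hSfin : S.Finite := finite_of_encard_eq_coe (k := n + 1) (by exact_mod_cast hS)
      have hinj : InjOn Prod.fst S := by
        rintro ⟨A, g⟩ hp ⟨B, h⟩ hq (rfl : A = B)
        rw [(hT.unique A ⟨_, hST hp, rfl⟩).unique (hST hp) (hST hq)]
      have hSn : S.ncard = n + 1 := by
        rw [Set.ncard, hS]; rfl
      refine ⟨hSfin.toFinset.image Prod.fst, ?_, ?_, ?_⟩
      · rw [Finset.card_image_of_injOn (by simpa using hinj), ← Set.ncard_eq_toFinset_card S hSfin,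
          hSn]
      · rw [Finset.coe_image, Finite.coe_toFinset]
        rintro _ ⟨p, hp, rfl⟩ _ ⟨q, hq, rfl⟩ -
        rcases eq_or_ne p q with rfl | hpq
        · exact Or.inl Subset.rfl
        have hle : ∀ {p q}, SignedLE p q → p.1 ⊆ q.1 := by
          intro p q h
          rcases Prod.lex_def.1 h with h | h
          exacts [h.subset, h.1.subset]
        exact (hT.chain (hST hp) (hST hq) hpq).imp hle hle
      · intro A hA
        obtain ⟨p, hp, rfl⟩ := Finset.mem_image.1 hA
        exact ⟨p.2, hT.signedOrbital p (hST ((Finite.mem_toFinset _).1 hp))⟩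
  · rintro ⟨s, rfl, hs, hsG⟩
    choose! γ hγ hγ' using hsG
    have hinj : Function.Injective fun A : Set ℝ => (A, γ A) := fun A B e => congrArg Prod.fst e
    have hT : IsTower G ((fun A => (A, γ A)) '' (s : Set (Set ℝ))) := by
      refine ⟨?_, ?_, ?_⟩
      · rintro _ ⟨A, hA, rfl⟩
        exact ⟨hγ A hA, hγ' A hA⟩
      · rintro _ ⟨A, hA, rfl⟩ _ ⟨B, hB, rfl⟩ hne
        have hAB : A ≠ B := fun e => hne (by rw [e])
        exact (hs hA hB hAB).imp
          (fun h => Prod.lex_def.2 (Or.inl (h.ssubset_of_ne hAB)))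
          fun h => Prod.lex_def.2 (Or.inl (h.ssubset_of_ne hAB.symm))
      · rintro _ ⟨_, ⟨A, hA, rfl⟩, rfl⟩
        refine ⟨γ A, ⟨A, hA, rfl⟩, ?_⟩
        rintro g ⟨B, -, e⟩
        obtain ⟨rfl, rfl⟩ := Prod.mk.inj e
        rfl
    calc ((s.card : ℕ) : ℕ∞) = ((fun A => (A, γ A)) '' (s : Set (Set ℝ))).encard := by
          rw [hinj.encard_image, encard_coe_eq_coe_finsetCard]
      _ ≤ depth G := le_iSup (fun T : {T // IsTower G T} => (T : Set (Set ℝ × PLo)).encard) ⟨_, hT⟩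

theorem exists_isGreatest_of_isChain {s : Finset (Set ℝ)} (hne : s.Nonempty)
    (hs : IsChain (· ⊆ ·) (s : Set (Set ℝ))) : ∃ M ∈ s, ∀ A ∈ s, A ⊆ M := by
  obtain ⟨M, hM⟩ := s.exists_maximal hne
  exact ⟨M, hM.1, fun A hA => (hs.total hA hM.1).elim id fun h => hM.2 hA h⟩

theorem HasOrbitalChain.of_commutator {G : Subgroup PLo} {n : ℕ}
    (h : HasOrbitalChain ⁅G, G⁆ (n + 1)) : HasOrbitalChain G (n + 2) := by
  classical
  obtain ⟨s, hcard, hs, hsG⟩ := h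
  obtain ⟨M, hM, hmax⟩ := exists_isGreatest_of_isChain (Finset.card_pos.1 (by lia)) hs
  obtain ⟨f, hf, hfM⟩ := hsG M hM
  obtain ⟨a, b, hab, rfl⟩ := isElementOrbital_iff.1 hfM
  obtain ⟨g, hg, c, d, hcd, hca, hbd⟩ := exists_isBump_of_commutator hf hab
  have hsub : ∀ A ∈ s, A ⊆ Ioo (c : ℝ) d := fun A hA =>
    (hmax A hA).trans (Ioo_subset_Ioo (le_of_lt hca) (le_of_lt hbd))
  have hnot : Ioo (c : ℝ) d ∉ s := fun hmem =>
    lt_irrefl (a : ℝ) (hmax _ hmem ⟨hca, (hab.lt.trans hbd : a < d)⟩).1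
  refine ⟨insert (Ioo (c : ℝ) d) s, by rw [Finset.card_insert_of_notMem hnot, hcard], ?_, ?_⟩
  · rw [Finset.coe_insert]
    exact hs.insert fun A hA _ => Or.inr (hsub A hA)
  · intro A hA
    rcases Finset.mem_insert.1 hA with rfl | hA
    · exact ⟨g, hg, isElementOrbital_iff.2 ⟨c, d, hcd, rfl⟩⟩
    · obtain ⟨k, hk, hkA⟩ := hsG A hA
      exact ⟨k, Subgroup.commutator_le_self G hk, hkA⟩

theorem HasOrbitalChain.commutator {G : Subgroup PLo} (hG : IsLaminar G) {n : ℕ}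
    (h : HasOrbitalChain G (n + 1)) : HasOrbitalChain ⁅G, G⁆ n := by
  classical
  obtain ⟨s, hcard, hs, hsG⟩ := h
  obtain ⟨M, hM, hmax⟩ := exists_isGreatest_of_isChain (Finset.card_pos.1 (by lia)) hs
  refine ⟨s.erase M, by rw [Finset.card_erase_of_mem hM, hcard]; rfl,
    hs.mono (by simp), fun A hA => ?_⟩
  obtain ⟨hAM, hAs⟩ := Finset.mem_erase.1 hA
  obtain ⟨g, hg, hgA⟩ := hsG A hAs
  obtain ⟨h, hh, hhM⟩ := hsG M hM
  obtain ⟨a, b, hab, rfl⟩ := isElementOrbital_iff.1 hgA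
  obtain ⟨c, d, hcd, rfl⟩ := isElementOrbital_iff.1 hhM
  obtain ⟨hca, hbd⟩ := (Ioo_subset_Ioo_iff (show (a : ℝ) < b from hab.lt)).1 (hmax _ hAs)
  obtain ⟨f, hf, hfab⟩ := hG.exists_isBump_commutator hg hh hab hcd hca hbd (by
    by_contra! e
    exact hAM (by rw [e.1, e.2]))
  exact ⟨f, hf, isElementOrbital_iff.2 ⟨a, b, hfab, rfl⟩⟩

theorem hasOrbitalChain_one_iff {G : Subgroup PLo} : HasOrbitalChain G 1 ↔ G ≠ ⊥ := by
  constructor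
  · rintro ⟨s, hcard, -, hsG⟩ rfl
    obtain ⟨A, hA⟩ := Finset.card_pos.1 (by lia : 0 < s.card)
    obtain ⟨g, hg, hgA⟩ := hsG A hA
    obtain ⟨a, b, hab, -⟩ := isElementOrbital_iff.1 hgA
    obtain ⟨x, hax, hxb⟩ := exists_between hab.lt
    refine hab.moved x hax hxb ?_
    rw [Subgroup.mem_bot.1 hg, one_smul]
  · intro hG
    obtain ⟨g, hg, hg1⟩ := G.bot_or_exists_ne_one.resolve_left hG
    obtain ⟨x, hx⟩ : ∃ x : I, g • x ≠ x := by
      by_contra! hall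
      exact hg1 (ext_smul fun x => by rw [hall x, one_smul])
    obtain ⟨a, b, hab, -⟩ := exists_isBump hx
    refine ⟨{Ioo (a : ℝ) b}, rfl, by simp, fun A hA => ⟨g, hg, ?_⟩⟩
    rw [Finset.mem_singleton.1 hA]
    exact isElementOrbital_iff.2 ⟨a, b, hab, rfl⟩

theorem derivedSubgroup_eq_bot_iff (G : Subgroup PLo) (n : ℕ) :
    derivedSubgroup G n = ⊥ ↔ ¬ HasOrbitalChain G (n + 1) := by
  induction n generalizing G with
  | zero => rw [derivedSubgroup_zero, hasOrbitalChain_one_iff, not_not]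
  | succ n ih =>
    constructor
    · intro h hchain
      exact (ih _).1 h (hchain.commutator (isLaminar_of_derivedSubgroup_eq_bot h))
    · intro h
      exact (ih _).2 fun hchain => h hchain.of_commutator

theorem derivedSeries_eq_bot_iff_depth_le (G : Subgroup PLo) (n : ℕ) :
    derivedSeries G n = ⊥ ↔ depth G ≤ n := by
  rw [derivedSeries_eq_bot_iff, derivedSubgroup_eq_bot_iff, ← natCast_le_depth_iff, not_le,
    Nat.cast_add, Nat.cast_one, ENat.lt_add_one_iff (ENat.natCast_ne_top n)]

end PLo

theorem theorem1p1 (G : Subgroup PLo) (n : ℕ) :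
    HasDerivedLength G n ↔ PLo.depth G = n := by
  rw [HasDerivedLength]
  simp only [PLo.derivedSeries_eq_bot_iff_depth_le]
  constructor
  · rintro ⟨hn, hmin⟩
    refine le_antisymm hn ?_
    by_contra! hlt
    obtain ⟨m, hm⟩ := ENat.ne_top_iff_exists.1 (hlt.trans_le le_top).ne
    rw [← hm] at hlt
    exact not_le_of_gt (Nat.cast_lt.1 hlt) (hmin hm.ge)
  · intro h
    exact ⟨h.le, fun m (hm : PLo.depth G ≤ m) => by rw [h] at hm; exact_mod_cast hm⟩
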